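/- Let $\kappa=\nu^+$ be the successor of an infinite cardinal $\nu$. For an infinite cardinal $\lambda$, a linear order $P$ is $\lambda$-dense if $|P|>1$ and every open interval $(a,b)$ with $a<b$ in $P$ has at least $\lambda$ elements; it is $\lambda$-saturated if $P\neq\emptyset$ and for all (possibly empty) $A,B\subseteq P$ with $|A|,|B|<\lambda$ and $a<b$ for all $a\in A$, $b\in B$, there is $c\in P$ with $a<c<b$ for all $a\in A$, $b\in B$. For an infinite regular cardinal $\lambda$, a linear order type is $\lambda$-scattered (respectively weakly $\lambda$-scattered) if no $\lambda$-dense (respectively no $\lambda$-saturated) order type embeds into it, and it is $\langle\aleph_0,\kappa\rangle$-scattered if an order of that type is the union of a family of fewer than $\kappa$ suborders, each of $\aleph_0$-scattered type. Let $\mathcal{S}_\kappa$, $\mathcal{S}_{\aleph_0,\kappa}$ and $\mathcal{WS}_\kappa$ be the classes of $\kappa$-scattered, $\langle\aleph_0,\kappa\rangle$-scattered and weakly $\kappa$-scattered linear order types, respectively. Then $$\mathcal{S}_\kappa\subsetneq\mathcal{S}_{\aleph_0,\kappa}\subsetneq\mathcal{WS}_\kappa.$$ -/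

import Mathlib

universe u

open Cardinal

namespace GenScattered

/-- The linear order `P` is `κ`-dense: it has more than one point, and every open interval with
endpoints `a < b` in `P` has at least `κ` points. -/
def IsDenseOrder (κ : Cardinal.{u}) (P : Type u) [LinearOrder P] : Prop :=
  1 < #P ∧ ∀ a b : P, a < b → κ ≤ #(Set.Ioo a b)

/-- The linear order `P` is `κ`-saturated: it is nonempty, and whenever `A`, `B` are subsets of `P`
(possibly empty) of size less than `κ` with every element of `A` below every element of `B`, some
`c` in `P` lies strictly between `A` and `B`. -/
def IsSaturatedOrder (κ : Cardinal.{u}) (P : Type u) [LinearOrder P] : Prop :=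
  Nonempty P ∧ ∀ A B : Set P, #A < κ → #B < κ → (∀ a ∈ A, ∀ b ∈ B, a < b) →
    ∃ c : P, (∀ a ∈ A, a < c) ∧ (∀ b ∈ B, c < b)

/-- `κ`-dense order types. -/
def IsDenseType (κ : Cardinal.{u}) (φ : OrderType.{u}) : Prop :=
  IsDenseOrder κ φ.ToType

/-- `κ`-saturated order types. -/
def IsSaturatedType (κ : Cardinal.{u}) (φ : OrderType.{u}) : Prop :=
  IsSaturatedOrder κ φ.ToType

/-- `φ` is `κ`-scattered: no `κ`-dense order type embeds into `φ`. -/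
def IsScattered (κ : Cardinal.{u}) (φ : OrderType.{u}) : Prop :=
  ¬ ∃ τ : OrderType.{u}, IsDenseType κ τ ∧ τ ≤ φ

/-- `φ` is weakly `κ`-scattered: no `κ`-saturated order type embeds into `φ`. -/
def IsWeaklyScattered (κ : Cardinal.{u}) (φ : OrderType.{u}) : Prop :=
  ¬ ∃ τ : OrderType.{u}, IsSaturatedType κ τ ∧ τ ≤ φ

/-- The linear order `P` is the union of a family of fewer than `μ` suborders (subsets with the
induced order), each of `κ`-scattered order type. -/
def IsUnionOfScattered (κ μ : Cardinal.{u}) (P : Type u) [LinearOrder P] : Prop :=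
  ∃ ι : Type u, #ι < μ ∧ ∃ Q : ι → Set P,
    (∀ i, IsScattered κ (OrderType.type (Q i))) ∧ (⋃ i, Q i) = Set.univ

/-- `φ` is `⟨κ, μ⟩`-scattered: an order of type `φ` is the union of fewer than `μ` suborders of
`κ`-scattered type. -/
def IsPairScattered (κ μ : Cardinal.{u}) (φ : OrderType.{u}) : Prop :=
  IsUnionOfScattered κ μ φ.ToType

/-- The class of `κ`-scattered linear order types. -/
def scatteredTypes (κ : Cardinal.{u}) : Set OrderType.{u} :=
  {φ | IsScattered κ φ}

/-- The class of `⟨κ, μ⟩`-scattered linear order types. -/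
def pairScatteredTypes (κ μ : Cardinal.{u}) : Set OrderType.{u} :=
  {φ | IsPairScattered κ μ φ}

/-- The class of weakly `κ`-scattered linear order types. -/
def weaklyScatteredTypes (κ : Cardinal.{u}) : Set OrderType.{u} :=
  {φ | IsWeaklyScattered κ φ}

/-! The definitions above do not depend on the representative chosen for an order type. -/

theorem IsDenseOrder.congr {κ : Cardinal.{u}} {P Q : Type u} [LinearOrder P] [LinearOrder Q]
    (e : P ≃o Q) (h : IsDenseOrder κ P) : IsDenseOrder κ Q := by
  refine ⟨(Cardinal.mk_congr e.toEquiv) ▸ h.1, fun a b hab => ?_⟩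
  refine (h.2 (e.symm a) (e.symm b) (e.symm.lt_iff_lt.2 hab)).trans ?_
  refine Cardinal.mk_le_of_injective (f := fun x => ⟨e x.1, ?_, ?_⟩) ?_
  · exact e.symm_apply_lt.1 x.2.1
  · exact e.lt_symm_apply.1 x.2.2
  · intro x y hxy
    exact Subtype.ext (e.injective (congrArg Subtype.val hxy))

theorem IsSaturatedOrder.congr {κ : Cardinal.{u}} {P Q : Type u} [LinearOrder P] [LinearOrder Q]
    (e : P ≃o Q) (h : IsSaturatedOrder κ P) : IsSaturatedOrder κ Q := by
  refine ⟨h.1.map e, fun A B hA hB hAB => ?_⟩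
  obtain ⟨c, hc1, hc2⟩ := h.2 (e.symm '' A) (e.symm '' B)
    (Cardinal.mk_image_le.trans_lt hA) (Cardinal.mk_image_le.trans_lt hB) (by
      rintro _ ⟨a, ha, rfl⟩ _ ⟨b, hb, rfl⟩
      exact e.symm.lt_iff_lt.2 (hAB a ha b hb))
  exact ⟨e c, fun a ha => e.symm_apply_lt.1 (hc1 _ ⟨a, ha, rfl⟩),
    fun b hb => e.lt_symm_apply.1 (hc2 _ ⟨b, hb, rfl⟩)⟩

theorem IsUnionOfScattered.congr {κ μ : Cardinal.{u}} {P Q : Type u} [LinearOrder P]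
    [LinearOrder Q] (e : P ≃o Q) (h : IsUnionOfScattered κ μ P) : IsUnionOfScattered κ μ Q := by
  obtain ⟨ι, hι, R, hR, hU⟩ := h
  refine ⟨ι, hι, fun i => e '' R i, fun i => ?_, ?_⟩
  · have he : OrderType.type (R i) = OrderType.type (e '' R i) :=
      OrderType.type_congr ((e.toOrderEmbedding.strictMono.strictMonoOn _).orderIso _ _)
    exact he ▸ hR i
  · rw [← Set.image_iUnion, hU, Set.image_univ, e.range_eq]

theorem isDenseType_type {κ : Cardinal.{u}} {P : Type u} [LinearOrder P] :
    IsDenseType κ (OrderType.type P) ↔ IsDenseOrder κ P := by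
  obtain ⟨e⟩ := OrderType.type_eq_type.1 (OrderType.type_toType (OrderType.type P))
  exact ⟨fun h => h.congr e, fun h => IsDenseOrder.congr e.symm h⟩

theorem isSaturatedType_type {κ : Cardinal.{u}} {P : Type u} [LinearOrder P] :
    IsSaturatedType κ (OrderType.type P) ↔ IsSaturatedOrder κ P := by
  obtain ⟨e⟩ := OrderType.type_eq_type.1 (OrderType.type_toType (OrderType.type P))
  exact ⟨fun h => h.congr e, fun h => IsSaturatedOrder.congr e.symm h⟩

theorem isPairScattered_type {κ μ : Cardinal.{u}} {P : Type u} [LinearOrder P] :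
    IsPairScattered κ μ (OrderType.type P) ↔ IsUnionOfScattered κ μ P := by
  obtain ⟨e⟩ := OrderType.type_eq_type.1 (OrderType.type_toType (OrderType.type P))
  exact ⟨fun h => h.congr e, fun h => IsUnionOfScattered.congr e.symm h⟩

end GenScattered

namespace GenScattered

/-! Both inclusions and one of the strictness proofs use Hausdorff-style arguments about ideals or
dense pieces.

For the first inclusion, condense along the ideal of sets covered by `ν` scattered sets. By
`condensation`, an order outside the ideal contains a `κ`-dense suborder. The ideal passes from
bounded pieces to rays because a well ordered sum of scattered sets is scattered.

For the second, in a `κ`-saturated order one builds nested intervals avoiding each of fewer than `κ`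
scattered sets. A point common to all of them lies in none of these sets
(`IsSaturatedOrder.iUnion_ne_univ`).

The first strictness is witnessed by the eventually constant sequences `ℕ → κ` (one fixed eventual
value), ordered lexicographically. The second is witnessed by an order with more than `ν` points,
any two separated by one of `ν` cuts. No saturated order has so few cuts, yet condensing along sets
of size at most `ν` shows that its scattered suborders have at most `ν` points, so `ν` of them
cannot cover it. -/

/-- A subset of a linear order is scattered if it has no nontrivial densely ordered subset. -/
def SetScattered {P : Type u} [LinearOrder P] (S : Set P) : Prop :=
  ∀ T ⊆ S, T.Nontrivial → ¬ ∀ a ∈ T, ∀ b ∈ T, a < b → ∃ c ∈ T, a < c ∧ c < b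

/-! ### Scattered subsets and well ordered sums -/

section Basic

variable {P : Type u} [LinearOrder P]

theorem isScattered_mono {κ : Cardinal.{u}} {φ ψ : OrderType.{u}} (h : IsScattered κ φ)
    (hle : ψ ≤ φ) : IsScattered κ ψ :=
  fun ⟨τ, hτ, hl⟩ => h ⟨τ, hτ, hl.trans hle⟩

theorem not_isScattered_of_dense_subset {κ : Cardinal.{u}} {T : Set P} (h : IsDenseOrder κ T) :
    ¬ IsScattered κ (OrderType.type P) := fun hs =>
  hs ⟨OrderType.type T, isDenseType_type.2 h,
    OrderType.type_le_type (OrderEmbedding.subtype (· ∈ T))⟩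

theorem isDenseOrder_aleph0_iff :
    IsDenseOrder ℵ₀ P ↔ Nontrivial P ∧ DenselyOrdered P := by
  constructor
  · rintro ⟨h1, h2⟩
    refine ⟨one_lt_iff_nontrivial.1 h1, ⟨fun a b hab => ?_⟩⟩
    have : #(Set.Ioo a b) ≠ 0 := (aleph0_pos.trans_le (h2 a b hab)).ne'
    obtain ⟨⟨c, hc⟩⟩ := mk_ne_zero_iff.1 this
    exact ⟨c, hc⟩
  · rintro ⟨h1, h2⟩
    refine ⟨one_lt_iff_nontrivial.2 h1, fun a b hab => ?_⟩
    have := (Set.Ioo_infinite hab).to_subtype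
    exact aleph0_le_mk _

theorem isScattered_aleph0_type_iff {S : Set P} :
    IsScattered ℵ₀ (OrderType.type S) ↔ SetScattered S := by
  constructor
  · intro h T hTS hT hd
    refine h ⟨OrderType.type T, isDenseType_type.2 (isDenseOrder_aleph0_iff.2 ⟨hT.coe_sort, ⟨?_⟩⟩),
      OrderType.type_le_type ⟨⟨Set.inclusion hTS, Set.inclusion_injective hTS⟩, Iff.rfl⟩⟩
    rintro ⟨a, ha⟩ ⟨b, hb⟩ hab
    obtain ⟨c, hc, hc'⟩ := hd a ha b hb hab
    exact ⟨⟨c, hc⟩, hc'⟩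
  · rintro h ⟨τ, hτ, hle⟩
    rw [← OrderType.type_toType τ] at hle
    obtain ⟨e⟩ := OrderType.type_le_type_iff.1 hle
    obtain ⟨h1, h2⟩ := isDenseOrder_aleph0_iff.1 hτ
    have hinj : Function.Injective fun x => (e x : P) :=
      Subtype.val_injective.comp e.injective
    refine h (Set.range fun x => (e x : P)) ?_ ?_ ?_
    · rintro _ ⟨x, rfl⟩
      exact (e x).2
    · obtain ⟨x, y, hxy⟩ := h1
      exact ⟨_, ⟨x, rfl⟩, _, ⟨y, rfl⟩, hinj.ne hxy⟩
    · rintro _ ⟨x, rfl⟩ _ ⟨y, rfl⟩ hxy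
      obtain ⟨z, hz, hz'⟩ := exists_between (e.lt_iff_lt.1 hxy)
      exact ⟨_, ⟨z, rfl⟩, e.lt_iff_lt.2 hz, e.lt_iff_lt.2 hz'⟩

theorem SetScattered.subset {S T : Set P} (h : SetScattered S) (hT : T ⊆ S) : SetScattered T :=
  fun U hU => h U (hU.trans hT)

theorem setScattered_of_subsingleton {S : Set P} (h : S.Subsingleton) : SetScattered S :=
  fun _ hT hn => (Set.not_subsingleton_iff.2 hn (h.anti hT)).elim

theorem SetScattered.dual {S : Set P} (h : SetScattered S) :
    SetScattered (OrderDual.ofDual ⁻¹' S) := by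
  intro T hT hn hd
  refine h (OrderDual.toDual ⁻¹' T) hT hn fun a ha b hb hab => ?_
  obtain ⟨c, hc, h1, h2⟩ := hd (OrderDual.toDual b) hb (OrderDual.toDual a) ha hab
  exact ⟨OrderDual.ofDual c, hc, h2, h1⟩

/-- A set which is a well ordered sum of scattered sets is scattered. -/
theorem SetScattered.of_monotoneOn {W : Type*} [LinearOrder W] [WellFoundedLT W] {S : Set P}
    {f : P → W} (hf : MonotoneOn f S) (h : ∀ w, SetScattered {x ∈ S | f x = w}) :
    SetScattered S := by
  intro T hT hn hd
  obtain ⟨a, ha, b, hb, hab⟩ := hn.exists_lt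
  -- By monotonicity, the part of `T` between two points with equal value stays in one fibre, where
  -- it would be dense.
  by_cases hfib : ∃ x ∈ T, ∃ y ∈ T, x < y ∧ f x = f y
  · obtain ⟨x, hx, y, hy, hxy, hfxy⟩ := hfib
    refine h (f x) (T ∩ Set.Icc x y) ?_
      ⟨x, ⟨hx, le_rfl, hxy.le⟩, y, ⟨hy, hxy.le, le_rfl⟩, hxy.ne⟩ ?_
    · rintro z ⟨hz, hxz, hzy⟩
      exact ⟨hT hz, le_antisymm (hfxy ▸ hf (hT hz) (hT hy) hzy) (hf (hT hx) (hT hz) hxz)⟩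
    · rintro p ⟨hp, hxp, -⟩ q ⟨hq, -, hqy⟩ hpq
      obtain ⟨c, hc, h1, h2⟩ := hd p hp q hq hpq
      exact ⟨c, ⟨hc, hxp.trans h1.le, h2.le.trans hqy⟩, h1, h2⟩
  · push Not at hfib
    -- With `f` injective on `T`, a point above `a` of least value is an immediate successor of `a`
    -- in `T`.
    obtain ⟨m, ⟨⟨hmT, ham⟩, hm⟩⟩ : ∃ m, (m ∈ T ∧ a < m) ∧ ∀ z, z ∈ T → a < z → f m ≤ f z := by
      have hne : {w | ∃ z ∈ T, a < z ∧ f z = w}.Nonempty := ⟨f b, b, hb, hab, rfl⟩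
      obtain ⟨m, hm, ham, hfm⟩ := WellFounded.min_mem (wellFounded_lt (α := W)) _ hne
      refine ⟨m, ⟨hm, ham⟩, fun z hz haz => ?_⟩
      rw [hfm]
      exact WellFounded.min_le wellFounded_lt (show f z ∈ {w | ∃ z ∈ T, a < z ∧ f z = w} from
        ⟨z, hz, haz, rfl⟩)
    obtain ⟨c, hc, hac, hcm⟩ := hd a ha m hmT ham
    exact hfib c hc m hmT hcm (le_antisymm (hf (hT hc) (hT hmT) hcm.le) (hm c hc hac))

end Basic

/-- Hausdorff condensation: if `G` is an ideal of subsets closed under unions of fewer than `κ`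
sets, and a ray all of whose bounded pieces are in `G` is itself in `G`, then either the whole order
is in `G` or it contains a `κ`-dense suborder. -/
theorem condensation {P : Type u} [LinearOrder P] {κ : Cardinal.{u}} (hκ : ℵ₀ ≤ κ)
    (G : Set P → Prop) (mono : ∀ S T, S ⊆ T → G T → G S)
    (iUnion : ∀ (ι : Type u) (s : ι → Set P), #ι < κ → (∀ i, G (s i)) → G (⋃ i, s i))
    (single : ∀ x, G {x})
    (up : ∀ x C, (∀ y ∈ C, x ≤ y ∧ G (Set.Icc x y)) → G C)
    (down : ∀ x C, (∀ y ∈ C, y ≤ x ∧ G (Set.Icc y x)) → G C) :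
    G Set.univ ∨ ∃ T : Set P, IsDenseOrder κ T := by
  have union : ∀ S T, G S → G T → G (S ∪ T) := by
    intro S T hS hT
    have := iUnion (ULift Bool) (fun b => cond b.down S T)
      ((lt_aleph0_of_finite _).trans_le hκ) (by rintro ⟨_ | _⟩ <;> assumption)
    refine mono _ _ ?_ this
    rintro x (hx | hx)
    · exact Set.mem_iUnion.2 ⟨⟨true⟩, hx⟩
    · exact Set.mem_iUnion.2 ⟨⟨false⟩, hx⟩
  let r : Setoid P :=
    { r := fun x y => G (Set.uIcc x y)
      iseqv :=
        { refl := fun x => by simpa using single x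
          symm := fun {x y} h => by rwa [Set.uIcc_comm]
          trans := fun {x y z} h h' =>
            mono _ _ Set.uIcc_subset_uIcc_union_uIcc (union _ _ h h') } }
  have cls : ∀ x, G {y | r x y} := by
    intro x
    refine mono _ ({y | r x y ∧ x ≤ y} ∪ {y | r x y ∧ y ≤ x}) ?_ (union _ _ ?_ ?_)
    · intro y hy
      exact (le_total x y).imp (fun h => ⟨hy, h⟩) (fun h => ⟨hy, h⟩)
    · refine up x _ fun y hy => ⟨hy.2, ?_⟩
      rw [← Set.uIcc_of_le hy.2]
      exact hy.1
    · refine down x _ fun y hy => ⟨hy.2, ?_⟩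
      rw [← Set.uIcc_of_ge hy.2]
      exact hy.1
  -- One representative per condensation class; these form the dense suborder unless there is a
  -- single class.
  let rep : P → P := fun x => (Quotient.mk r x).out
  have hrep : ∀ x, r (rep x) x := fun x => Quotient.mk_out x
  have huniq : ∀ x y, r (rep x) (rep y) → rep x = rep y := by
    intro x y h
    have : r x y := r.trans (r.symm (hrep x)) (r.trans h (hrep y))
    exact congrArg Quotient.out (Quotient.sound this)
  by_cases hsub : (Set.range rep).Subsingleton
  · left
    rcases isEmpty_or_nonempty P with hP | ⟨⟨x⟩⟩
    · refine mono _ (⋃ i : PEmpty.{u + 1}, i.elim) (fun x => (hP.false x).elim)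
        (iUnion _ _ ?_ fun i => i.elim)
      simpa using aleph0_pos.trans_le hκ
    · refine mono _ _ (fun y _ => ?_) (cls (rep x))
      have := hsub ⟨x, rfl⟩ ⟨y, rfl⟩
      simpa [this] using hrep y
  · right
    rw [Set.not_subsingleton_iff] at hsub
    refine ⟨Set.range rep, one_lt_iff_nontrivial.2 hsub.coe_sort, ?_⟩
    rintro ⟨_, x, rfl⟩ ⟨_, y, rfl⟩ hxy
    by_contra! hlt
    have hxy' : rep x < rep y := hxy
    refine hxy'.ne (huniq x y ?_)
    change G (Set.uIcc _ _)
    rw [Set.uIcc_of_le hxy'.le]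
    -- With fewer than `κ` representatives in between, the interval is covered by few classes, so
    -- its endpoints would be equivalent.
    refine mono _ _ ?_ (union _ _ (union _ _ (cls (rep x)) (cls (rep y)))
      (iUnion _ (fun t => {z | r t.1.1 z}) hlt fun t => cls _))
    rintro z ⟨hxz, hzy⟩
    rcases le_or_gt (rep z) (rep x) with h1 | h1
    · left; left
      refine mono _ _ ?_ (hrep z)
      exact Set.uIcc_subset_uIcc_right (Set.mem_uIcc_of_le h1 hxz)
    rcases le_or_gt (rep y) (rep z) with h2 | h2
    · left; right
      refine mono _ _ ?_ (hrep z)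
      exact Set.uIcc_subset_uIcc_right (Set.mem_uIcc_of_ge hzy h2)
    · right
      exact Set.mem_iUnion.2 ⟨⟨⟨rep z, z, rfl⟩, h1, h2⟩, hrep z⟩

/-! ### Covers by `ν` scattered sets and the first inclusion -/

section Cover

variable {P : Type u} [LinearOrder P]

/-- `S` is covered by `ν` many scattered sets. -/
def ScatteredCover (ν : Cardinal.{u}) (S : Set P) : Prop :=
  ∃ Q : ν.out → Set P, (∀ i, SetScattered (Q i)) ∧ S ⊆ ⋃ i, Q i

theorem scatteredCover_of_family {ν : Cardinal.{u}} {S : Set P} {ι : Type u} (hι : #ι ≤ ν)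
    (Q : ι → Set P) (hQ : ∀ i, SetScattered (Q i)) (hS : S ⊆ ⋃ i, Q i) : ScatteredCover ν S := by
  obtain ⟨e⟩ : Nonempty (ι ↪ ν.out) := by rwa [← Cardinal.le_def, mk_out]
  refine ⟨Function.extend e Q fun _ => ∅, fun i => ?_, hS.trans ?_⟩
  · by_cases hi : ∃ j, e j = i
    · obtain ⟨j, rfl⟩ := hi
      rw [e.injective.extend_apply]
      exact hQ j
    · rw [Function.extend_apply' _ _ _ hi]
      exact setScattered_of_subsingleton Set.subsingleton_empty
  · refine Set.iUnion_subset fun i x hx => Set.mem_iUnion.2 ⟨e i, ?_⟩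
    rwa [e.injective.extend_apply]

theorem ScatteredCover.mono {ν : Cardinal.{u}} {S T : Set P} (hST : S ⊆ T)
    (h : ScatteredCover ν T) : ScatteredCover ν S :=
  let ⟨Q, hQ, hT⟩ := h
  ⟨Q, hQ, hST.trans hT⟩

theorem ScatteredCover.dual {ν : Cardinal.{u}} {S : Set P} (h : ScatteredCover ν S) :
    ScatteredCover ν (OrderDual.ofDual ⁻¹' S) := by
  obtain ⟨Q, hQ, hS⟩ := h
  refine ⟨fun i => OrderDual.ofDual ⁻¹' Q i, fun i => (hQ i).dual, ?_⟩
  rw [← Set.preimage_iUnion]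
  exact Set.preimage_mono hS

theorem scatteredCover_iUnion {ν : Cardinal.{u}} (hν : ℵ₀ ≤ ν) (ι : Type u) (s : ι → Set P)
    (hι : #ι ≤ ν) (h : ∀ i, ScatteredCover ν (s i)) : ScatteredCover ν (⋃ i, s i) := by
  choose Q hQ hs using h
  refine scatteredCover_of_family (ι := ι × ν.out) ?_ (fun p => Q p.1 p.2) (fun p => hQ _ _) ?_
  · rw [mk_prod, lift_id, lift_id, mk_out]
    exact (mul_le_mul_left hι ν).trans (mul_eq_self hν).le
  · refine Set.iUnion_subset fun i x hx => ?_
    obtain ⟨j, hj⟩ := Set.mem_iUnion.1 (hs i hx)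
    exact Set.mem_iUnion.2 ⟨(i, j), hj⟩

/-- Send `y` to the first element of `C` above it in a fixed well-ordering of `P`. This map is
monotone on `C`, and each fibre lies in one interval `Icc x _`, hence has a cover. Uniting the
`i`-th pieces over all fibres gives a well ordered sum. -/
theorem scatteredCover_up {ν : Cardinal.{u}} (x : P) (C : Set P)
    (h : ∀ y ∈ C, x ≤ y ∧ ScatteredCover ν (Set.Icc x y)) : ScatteredCover ν C := by
  classical
  obtain ⟨e⟩ : Nonempty (P ≃ (#P).ord.ToType) := by
    rw [← Cardinal.eq, mk_toType, card_ord]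
  let A : P → Set (#P).ord.ToType := fun y => {w | e.symm w ∈ C ∧ y ≤ e.symm w}
  have hA : ∀ y ∈ C, (A y).Nonempty := fun y hy => ⟨e y, by simpa [A] using hy⟩
  let f : P → (#P).ord.ToType := fun y =>
    if hy : (A y).Nonempty then (wellFounded_lt (α := (#P).ord.ToType)).min (A y) hy else e y
  have hf : ∀ y ∈ C, f y ∈ A y := by
    intro y hy
    simp only [f, dif_pos (hA y hy)]
    exact WellFounded.min_mem _ _ _
  have hle : ∀ y ∈ C, ∀ w ∈ A y, f y ≤ w := by
    intro y hy w hw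
    simp only [f, dif_pos (hA y hy)]
    exact WellFounded.min_le wellFounded_lt hw
  have hmono : MonotoneOn f C := fun y hy z hz hyz =>
    hle y hy _ ⟨(hf z hz).1, hyz.trans (hf z hz).2⟩
  have hQ' : ∀ w : (#P).ord.ToType, ∃ Q : ν.out → Set P, (∀ i, SetScattered (Q i)) ∧
      (e.symm w ∈ C → Set.Icc x (e.symm w) ⊆ ⋃ i, Q i) := by
    intro w
    by_cases hw : e.symm w ∈ C
    · obtain ⟨Q, h1, h2⟩ := (h _ hw).2
      exact ⟨Q, h1, fun _ => h2⟩
    · exact ⟨fun _ => ∅, fun _ => setScattered_of_subsingleton Set.subsingleton_empty,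
        fun h => (hw h).elim⟩
  choose Q hQ hcov using hQ'
  refine ⟨fun i => {y ∈ C | y ∈ Q (f y) i}, fun i => ?_, fun y hy => ?_⟩
  · refine SetScattered.of_monotoneOn (hmono.mono fun y hy => hy.1) fun w => (hQ w i).subset ?_
    rintro y ⟨⟨-, hy⟩, rfl⟩
    exact hy
  · obtain ⟨i, hi⟩ := Set.mem_iUnion.1 (hcov (f y) (hf y hy).1 ⟨(h y hy).1, (hf y hy).2⟩)
    exact Set.mem_iUnion.2 ⟨i, hy, hi⟩

theorem scatteredCover_down {ν : Cardinal.{u}} (x : P) (C : Set P)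
    (h : ∀ y ∈ C, y ≤ x ∧ ScatteredCover ν (Set.Icc y x)) : ScatteredCover ν C := by
  refine (scatteredCover_up (OrderDual.toDual x) (OrderDual.ofDual ⁻¹' C) fun y hy => ?_).dual
  refine ⟨(h _ hy).1, (h _ hy).2.dual.mono ?_⟩
  rintro z ⟨h1, h2⟩
  exact ⟨h2, h1⟩

end Cover

theorem scatteredTypes_subset {κ ν : Cardinal.{u}} (hν : ℵ₀ ≤ ν) (hκ : κ = Order.succ ν) :
    scatteredTypes κ ⊆ pairScatteredTypes ℵ₀ κ := by
  intro φ hφ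
  have hlt : ∀ c : Cardinal.{u}, c < κ ↔ c ≤ ν := fun c => by rw [hκ, Order.lt_succ_iff]
  rcases condensation (P := φ.ToType) (κ := κ) (hν.trans ((hlt ν).2 le_rfl).le) (ScatteredCover ν)
    (fun _ _ h h' => h'.mono h)
    (fun ι s hι h => scatteredCover_iUnion hν ι s ((hlt _).1 hι) h)
    (fun x => scatteredCover_of_family (ι := PUnit) (by simpa using one_le_aleph0.trans hν)
      (fun _ => {x}) (fun _ => setScattered_of_subsingleton Set.subsingleton_singleton)
      (fun y hy => Set.mem_iUnion.2 ⟨⟨⟩, hy⟩))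
    scatteredCover_up scatteredCover_down with h | ⟨T, hT⟩
  · obtain ⟨Q, hQ, hU⟩ := h
    exact ⟨ν.out, (hlt _).2 (mk_out ν).le, Q, fun i => isScattered_aleph0_type_iff.2 (hQ i),
      Set.univ_subset_iff.1 hU⟩
  · refine (not_isScattered_of_dense_subset hT ?_).elim
    rw [OrderType.type_toType]
    exact hφ

/-! ### Saturated orders and the second inclusion -/

/-- A saturated order of degree `κ` is not a union of fewer than `κ` scattered sets. -/
theorem IsSaturatedOrder.iUnion_ne_univ {κ : Cardinal.{u}} (hκ : ℵ₀ ≤ κ) {P : Type u}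
    [LinearOrder P] (h : IsSaturatedOrder κ P) {ι : Type u} (hι : #ι < κ) (Q : ι → Set P)
    (hQ : ∀ i, SetScattered (Q i)) : (⋃ i, Q i) ≠ Set.univ := by
  classical
  obtain ⟨⟨p₀⟩, hsat⟩ := h
  have hfin : ∀ S : Set P, S.Finite → #S < κ := fun S hS =>
    (Cardinal.lt_aleph0_iff_set_finite.2 hS).trans_le hκ
  have hdense : ∀ a b : P, a < b → ∃ c, a < c ∧ c < b := by
    intro a b hab
    obtain ⟨c, h1, h2⟩ := hsat {a} {b} (hfin _ (Set.finite_singleton _))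
      (hfin _ (Set.finite_singleton _)) (by simpa using hab)
    exact ⟨c, h1 a rfl, h2 b rfl⟩
  -- Otherwise `Q i` meets every subinterval strictly inside `(a, b)`, so its trace on `(a, b)` is
  -- dense.
  have havoid : ∀ i a b, a < b → ∃ p : P × P, a < p.1 ∧ p.1 < p.2 ∧ p.2 < b ∧
      ∀ c ∈ Q i, p.1 < c → ¬ c < p.2 := by
    intro i a b hab
    by_contra! hcon
    have key : ∀ x y, a < x → x < y → y < b → ∃ c ∈ Q i, x < c ∧ c < y :=
      fun x y h1 h2 h3 => hcon (x, y) h1 h2 h3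
    obtain ⟨c, hac, hcb⟩ := hdense a b hab
    obtain ⟨a', haa', ha'c⟩ := hdense a c hac
    obtain ⟨b', hcb', hb'b⟩ := hdense c b hcb
    obtain ⟨s, hs, h1, h2⟩ := key a' c haa' ha'c hcb
    obtain ⟨t, ht, h3, h4⟩ := key c b' hac hcb' hb'b
    refine hQ i (Q i ∩ Set.Ioo a b) Set.inter_subset_left
      ⟨s, ⟨hs, haa'.trans h1, h2.trans hcb⟩, t, ⟨ht, hac.trans h3, h4.trans hb'b⟩,
        (h2.trans h3).ne⟩ ?_
    rintro x ⟨-, hx, -⟩ y ⟨-, -, hy⟩ hxy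
    obtain ⟨c, hc, h5, h6⟩ := key x y hx hxy hy
    exact ⟨c, ⟨hc, hx.trans h5, h6.trans hy⟩, h5, h6⟩
  obtain ⟨r, hr⟩ : ∃ r : ι → ι → Prop, IsWellOrder ι r := ⟨WellOrderingRel, inferInstance⟩
  let good : ∀ i, (∀ j, r j i → P × P) → P × P → Prop := fun i F p =>
    p.1 < p.2 ∧ (∀ j (hj : r j i), (F j hj).1 < p.1 ∧ p.2 < (F j hj).2) ∧
      ∀ c ∈ Q i, p.1 < c → ¬ c < p.2
  -- The default `(p₀, p₀)` is never taken: `hgood` shows that a good pair always exists.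
  let step : ∀ i, (∀ j, r j i → P × P) → P × P := fun i F =>
    if hp : ∃ p, good i F p then hp.choose else (p₀, p₀)
  let F : ι → P × P := hr.wf.fix step
  have hF : ∀ i, F i = step i fun j _ => F j := fun i => hr.wf.fix_eq step i
  have hcut : ∀ s : Set ι, (∀ i ∈ s, good i (fun j _ => F j) (F i)) →
      ∃ c, (∀ i ∈ s, (F i).1 < c) ∧ ∀ i ∈ s, c < (F i).2 := by
    intro s hs
    obtain ⟨c, h1, h2⟩ := hsat ((fun i => (F i).1) '' s) ((fun i => (F i).2) '' s)
      (mk_image_le.trans_lt ((mk_set_le s).trans_lt hι))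
      (mk_image_le.trans_lt ((mk_set_le s).trans_lt hι)) (by
        rintro _ ⟨i, hi, rfl⟩ _ ⟨j, hj, rfl⟩
        rcases trichotomous_of r i j with hij | rfl | hij
        · exact (((hs j hj).2.1 i hij).1).trans (hs j hj).1
        · exact (hs i hi).1
        · exact (hs i hi).1.trans ((hs i hi).2.1 j hij).2)
    exact ⟨c, fun i hi => h1 _ ⟨i, hi, rfl⟩, fun i hi => h2 _ ⟨i, hi, rfl⟩⟩
  have hgood : ∀ i, good i (fun j _ => F j) (F i) := by
    intro i
    induction i using hr.wf.induction with
    | _ i ih =>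
      have hex : ∃ p, good i (fun j _ => F j) p := by
        obtain ⟨c, h1, h2⟩ := hcut {j | r j i} ih
        -- An interval found inside `(c, d)` nests strictly in all earlier ones.
        obtain ⟨d, h3, h4⟩ := hsat {c} ((fun j => (F j).2) '' {j | r j i})
          (hfin _ (Set.finite_singleton _))
          (mk_image_le.trans_lt ((mk_set_le _).trans_lt hι)) (by
            rintro a rfl _ ⟨j, hj, rfl⟩
            exact h2 j hj)
        obtain ⟨p, h5, h6, h7, h8⟩ := havoid i c d (h3 c rfl)
        exact ⟨p, h6, fun j hj => ⟨(h1 j hj).trans h5, h7.trans (h4 _ ⟨j, hj, rfl⟩)⟩, h8⟩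
      have : F i = hex.choose := by rw [hF]; simp only [step, dif_pos hex]
      rw [this]
      exact hex.choose_spec
  obtain ⟨c, h1, h2⟩ := hcut Set.univ fun i _ => hgood i
  intro hU
  obtain ⟨i, hi⟩ := Set.mem_iUnion.1 (hU ▸ Set.mem_univ c)
  exact (hgood i).2.2 c hi (h1 i trivial) (h2 i trivial)

theorem pairScatteredTypes_subset {κ : Cardinal.{u}} (hκ : ℵ₀ ≤ κ) :
    pairScatteredTypes ℵ₀ κ ⊆ weaklyScatteredTypes κ := by
  rintro φ ⟨ι, hι, Q, hQ, hU⟩ ⟨τ, hτ, hle⟩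
  rw [← OrderType.type_toType τ, ← OrderType.type_toType φ] at hle
  obtain ⟨e⟩ := OrderType.type_le_type_iff.1 hle
  refine IsSaturatedOrder.iUnion_ne_univ hκ hτ hι (fun i => e ⁻¹' Q i) (fun i => ?_) ?_
  · refine isScattered_aleph0_type_iff.1 (isScattered_mono (hQ i) (OrderType.type_le_type ?_))
    exact ⟨⟨fun x => ⟨e x.1, x.2⟩, fun x y hxy => Subtype.ext (e.injective
      (congrArg Subtype.val hxy))⟩, e.le_iff_le⟩
  · rw [← Set.preimage_iUnion, hU, Set.preimage_univ]

/-! ### Orders with few cuts: second strictness -/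

/-- `P` has a family of at most `ν` lower sets separating its points. -/
def HasCuts (ν : Cardinal.{u}) (P : Type u) [LinearOrder P] : Prop :=
  ∃ L : Set (Set P), #L ≤ ν ∧ (∀ l ∈ L, IsLowerSet l) ∧ ∀ x y, x < y → ∃ l ∈ L, x ∈ l ∧ y ∉ l

theorem HasCuts.of_embedding {ν : Cardinal.{u}} {P Q : Type u} [LinearOrder P] [LinearOrder Q]
    (e : Q ↪o P) (h : HasCuts ν P) : HasCuts ν Q := by
  obtain ⟨L, hL, hlow, hsep⟩ := h
  refine ⟨(fun l => e ⁻¹' l) '' L, mk_image_le.trans hL, ?_, fun x y hxy => ?_⟩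
  · rintro _ ⟨l, hl, rfl⟩ x y hxy hx
    exact hlow l hl (e.monotone hxy) hx
  · obtain ⟨l, hl, h1, h2⟩ := hsep _ _ (e.lt_iff_lt.2 hxy)
    exact ⟨_, ⟨l, hl, rfl⟩, h1, h2⟩

theorem HasCuts.dual {ν : Cardinal.{u}} {P : Type u} [LinearOrder P] (h : HasCuts ν P) :
    HasCuts ν Pᵒᵈ := by
  obtain ⟨L, hL, hlow, hsep⟩ := h
  refine ⟨(fun l => OrderDual.ofDual ⁻¹' lᶜ) '' L, mk_image_le.trans hL, ?_, fun x y hxy => ?_⟩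
  · rintro _ ⟨l, hl, rfl⟩ x y hxy hx hy
    exact hx (hlow l hl hxy hy)
  · obtain ⟨l, hl, h1, h2⟩ := hsep _ _ (OrderDual.ofDual_lt_ofDual.2 hxy)
    exact ⟨_, ⟨l, hl, rfl⟩, h2, fun h => h h1⟩

/-- Pick a point outside each proper cut. Saturation puts some `c` above all of these, so every
proper cut omits `c` and none separates `c` from a larger point. -/
theorem IsSaturatedOrder.not_hasCuts {κ ν : Cardinal.{u}} (hν : ℵ₀ ≤ ν) (hκ : ν < κ) {P : Type u}
    [LinearOrder P] (h : IsSaturatedOrder κ P) : ¬ HasCuts ν P := by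
  rintro ⟨L, hL, hlow, hsep⟩
  obtain ⟨⟨p₀⟩, hsat⟩ := h
  have hq : ∀ l : Set P, ∃ q, (∃ p, p ∉ l) → q ∉ l := by
    intro l
    by_cases hl : ∃ p, p ∉ l
    · exact ⟨hl.choose, fun _ => hl.choose_spec⟩
    · exact ⟨p₀, fun h => (hl h).elim⟩
  choose q hq using hq
  have above : ∀ A : Set P, #A < κ → ∃ c, ∀ a ∈ A, a < c := by
    intro A hA
    obtain ⟨c, hc, -⟩ := hsat A ∅ hA (by simpa using (aleph0_pos.trans_le hν).trans hκ) (by simp)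
    exact ⟨c, hc⟩
  obtain ⟨c, hc⟩ := above (q '' L) (mk_image_le.trans_lt (hL.trans_lt hκ))
  obtain ⟨d, hd⟩ := above {c} (by simpa using (one_le_aleph0.trans hν).trans_lt hκ)
  obtain ⟨l, hl, h1, h2⟩ := hsep c d (hd c rfl)
  exact hq l ⟨d, h2⟩ (hlow l hl (hc _ ⟨l, hl, rfl⟩).le h1)

theorem mk_iUnion_le_of_le {ν : Cardinal.{u}} (hν : ℵ₀ ≤ ν) {ι α : Type u} (s : ι → Set α)
    (hι : #ι ≤ ν) (h : ∀ i, #(s i) ≤ ν) : #(⋃ i, s i) ≤ ν :=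
  (mk_iUnion_le s).trans ((mul_le_mul' hι (ciSup_le' h)).trans (mul_eq_self hν).le)

/-- A non-greatest `z ∈ C` lies in a cut `l` omitting some `y ∈ C`. All points of `C ∩ l` then lie
in `Icc x y`, so each of the `ν` cuts accounts for at most `ν` points. -/
theorem HasCuts.mk_ray_le {ν : Cardinal.{u}} (hν : ℵ₀ ≤ ν) {P : Type u} [LinearOrder P]
    (h : HasCuts ν P) (x : P) (C : Set P) (hC : ∀ y ∈ C, x ≤ y ∧ #(Set.Icc x y) ≤ ν) :
    #C ≤ ν := by
  obtain ⟨L, hL, hlow, hsep⟩ := h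
  let s : L → Set P := fun l => {z | z ∈ C ∧ z ∈ l.1 ∧ ∃ y ∈ C, y ∉ l.1}
  have hs : #(⋃ l, s l) ≤ ν := by
    refine mk_iUnion_le_of_le hν s hL fun l => ?_
    by_cases hl : ∃ y ∈ C, y ∉ l.1
    · obtain ⟨y, hy, hyl⟩ := hl
      refine (mk_le_mk_of_subset ?_).trans (hC y hy).2
      rintro z ⟨hz, hzl, -⟩
      exact ⟨(hC z hz).1, le_of_not_ge fun hyz => hyl (hlow _ l.2 hyz hzl)⟩
    · have : s l = ∅ := Set.eq_empty_of_forall_notMem fun z hz => hl hz.2.2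
      simp [this]
  have hm : #{z | IsGreatest C z} ≤ ν := by
    refine (mk_le_one_iff_set_subsingleton.2 ?_).trans (one_le_aleph0.trans hν)
    exact fun a ha b hb => ha.unique hb
  refine (mk_le_mk_of_subset (t := (⋃ l, s l) ∪ {z | IsGreatest C z}) ?_).trans
    ((mk_union_le _ _).trans (add_le_of_le hν hs hm))
  intro z hz
  by_cases hg : ∃ y ∈ C, z < y
  · obtain ⟨y, hy, hzy⟩ := hg
    obtain ⟨l, hl, h1, h2⟩ := hsep z y hzy
    exact Or.inl (Set.mem_iUnion.2 ⟨⟨l, hl⟩, hz, h1, y, hy, h2⟩)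
  · push Not at hg
    exact Or.inr ⟨hz, hg⟩

/-- A scattered order with at most `ν` separating lower sets has at most `ν` points. -/
theorem HasCuts.mk_le_of_isScattered {ν : Cardinal.{u}} (hν : ℵ₀ ≤ ν) {P : Type u} [LinearOrder P]
    (h : HasCuts ν P) (hs : IsScattered ℵ₀ (OrderType.type P)) : #P ≤ ν := by
  rcases condensation (P := P) le_rfl (fun S => #S ≤ ν)
    (fun _ _ h h' => (mk_le_mk_of_subset h).trans h')
    (fun ι s hι h => mk_iUnion_le_of_le hν s (hι.le.trans hν) h)
    (fun x => by simpa using one_le_aleph0.trans hν)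
    (h.mk_ray_le hν)
    (fun x C hC => h.dual.mk_ray_le hν (OrderDual.toDual x) (OrderDual.ofDual ⁻¹' C) fun y hy =>
      ⟨(hC _ hy).1, by
        refine le_trans (le_of_eq ?_) (hC _ hy).2
        exact mk_congr ⟨fun z => ⟨z.1, z.2.2, z.2.1⟩, fun z => ⟨z.1, z.2.2, z.2.1⟩,
          fun _ => rfl, fun _ => rfl⟩⟩) with h | ⟨T, hT⟩
  · simpa using h
  · exact (not_isScattered_of_dense_subset hT hs).elim

/-- Take binary sequences of length `μ`, for the least `μ` with `ν < 2 ^ μ`. By minimality at most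
`ν` of them vanish beyond some index, and the cuts below these separate points. -/
theorem exists_hasCuts {ν : Cardinal.{u}} (hν : ℵ₀ ≤ ν) :
    ∃ (P : Type u) (_ : LinearOrder P), HasCuts ν P ∧ ν < #P := by
  classical
  have hex : {μ : Cardinal.{u} | ν < 2 ^ μ}.Nonempty := ⟨ν, cantor ν⟩
  obtain ⟨μ, hμ, hmin⟩ : ∃ μ : Cardinal.{u}, ν < 2 ^ μ ∧ ∀ c < μ, (2 : Cardinal.{u}) ^ c ≤ ν :=
    ⟨wellFounded_lt.min _ hex, wellFounded_lt.min_mem _ hex, fun c hc =>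
      not_lt.1 fun h => wellFounded_lt.not_lt_min _ (x := c) h hc⟩
  have hμν : μ ≤ ν := by
    by_contra! hlt
    exact (cantor ν).not_ge (hmin ν hlt)
  have hμ0 : ℵ₀ ≤ μ := by
    by_contra! hlt
    exact (hν.trans hμ.le).not_gt (power_lt_aleph0 natCast_lt_aleph0 hlt)
  let W := μ.ord.ToType
  have hW : #W = μ := by simp [W]
  have hIic : ∀ δ : W, #(Set.Iic δ) < μ := by
    intro δ
    have h1 : #(Set.Iio δ) < μ := by
      have := mk_Iio_lt δ (by simp [W])
      rwa [hW] at this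
    rw [← Set.Iio_insert]
    exact mk_insert_le.trans_lt (add_lt_of_lt hμ0 h1 (one_lt_aleph0.trans_le hμ0))
  let P := Lex (W → Bool)
  let D : W → Set P := fun δ => {g | ∀ ε, δ < ε → ofLex g ε = false}
  have hD : #(⋃ δ, D δ) ≤ ν := by
    refine mk_iUnion_le_of_le hν D (hW.trans_le hμν) fun δ => ?_
    refine le_trans (mk_le_of_injective (β := Set.Iic δ → ULift.{u} Bool)
      (f := fun g i => ⟨ofLex g.1 i.1⟩) ?_) (le_trans (le_of_eq ?_) (hmin _ (hIic δ)))
    · rintro ⟨f, hf⟩ ⟨g, hg⟩ hfg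
      refine Subtype.ext (funext fun i => ?_)
      rcases le_or_gt i δ with hi | hi
      · exact congrArg ULift.down (congrFun hfg ⟨i, hi⟩)
      · exact (hf i hi).trans (hg i hi).symm
    · simp
  refine ⟨P, inferInstance, ⟨Set.Iio '' ⋃ δ, D δ, mk_image_le.trans hD, ?_, ?_⟩, ?_⟩
  · rintro _ ⟨d, -, rfl⟩
    exact isLowerSet_Iio d
  · intro f g hfg
    obtain ⟨δ, heq, hlt⟩ : ∃ δ, (∀ ε < δ, f ε = g ε) ∧ f δ < g δ := hfg
    -- Truncating `g` after the first difference `δ` gives `f < d ≤ g`.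
    let d : P := toLex fun ε => if ε ≤ δ then ofLex g ε else false
    have hd : ∀ ε ≤ δ, d ε = g ε := fun ε hε => if_pos hε
    refine ⟨Set.Iio d, ⟨d, Set.mem_iUnion.2 ⟨δ, fun ε hε => if_neg hε.not_ge⟩, rfl⟩, ?_, ?_⟩
    · exact ⟨δ, fun ε hε => (heq ε hε).trans (hd ε hε.le).symm, (hd δ le_rfl).symm ▸ hlt⟩
    · rintro ⟨ε, h1, h2⟩
      rcases le_or_gt ε δ with hε | hε
      · exact absurd (hd ε hε) h2.ne'
      · have : d ε = false := if_neg hε.not_ge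
        rw [this] at h2
        exact absurd h2 (by simp)
  · have : #P = 2 ^ μ := by
      change #(W → Bool) = _
      simp [hW]
    rwa [this]

theorem not_isUnionOfScattered_of_hasCuts {κ ν : Cardinal.{u}} (hν : ℵ₀ ≤ ν)
    (hκ : κ = Order.succ ν) {P : Type u} [LinearOrder P] (h : HasCuts ν P) (hP : ν < #P) :
    ¬ IsUnionOfScattered ℵ₀ κ P := by
  rintro ⟨ι, hι, Q, hQ, hU⟩
  rw [hκ, Order.lt_succ_iff] at hι
  refine hP.not_ge ?_
  rw [← mk_univ, ← hU]
  exact mk_iUnion_le_of_le hν Q hι fun i =>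
    (h.of_embedding (OrderEmbedding.subtype (· ∈ Q i))).mk_le_of_isScattered hν (hQ i)

/-! ### A `κ`-dense union of countably many scattered orders: first strictness -/

theorem exists_dense_isUnionOfScattered {κ : Cardinal.{u}} (hκ : ℵ₀ < κ) :
    ∃ (P : Type u) (_ : LinearOrder P), IsDenseOrder κ P ∧ IsUnionOfScattered ℵ₀ κ P := by
  classical
  let W := κ.ord.ToType
  have hW : #W = κ := by simp [W]
  have hIoi : ∀ a : W, κ ≤ #(Set.Ioi a) := by
    intro a
    have h1 : #(Set.Iio a) < κ := by
      have := mk_Iio_lt a (by simp [W])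
      rwa [hW] at this
    have h2 : #(Set.Iic a) < #W := by
      rw [← Set.Iio_insert, hW]
      exact mk_insert_le.trans_lt (add_lt_of_lt hκ.le h1 (one_lt_aleph0.trans hκ))
    have : Infinite W := infinite_iff.2 (hW ▸ hκ.le)
    rw [← Set.compl_Iic, mk_compl_of_infinite _ h2, hW]
  obtain ⟨o⟩ : Nonempty W := mk_ne_zero_iff.1 (hW ▸ (aleph0_pos.trans hκ).ne')
  let P := {f : Lex (ℕ → W) // ∃ n, ∀ m, n ≤ m → f m = o}
  have hlt : ∀ f g : P, f < g ↔ ∃ n, (∀ m < n, f.1 m = g.1 m) ∧ f.1 n < g.1 n := fun f g => Iff.rfl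
  let put : ∀ (f : P) (n : ℕ) (w : W), P := fun f n w =>
    ⟨toLex (Function.update (ofLex f.1) n w), by
      obtain ⟨k, hk⟩ := f.2
      refine ⟨max k (n + 1), fun m hm => ?_⟩
      rw [Pi.toLex_apply, Function.update_of_ne (by have := le_of_max_le_right hm; omega)]
      exact hk m (le_of_max_le_left hm)⟩
  have put_self : ∀ f n w, (put f n w).1 n = w := fun f n w => Function.update_self ..
  have put_ne : ∀ f n w m, m ≠ n → (put f n w).1 m = f.1 m := fun f n w m h =>
    Function.update_of_ne h ..
  have put_inj : ∀ f n, Function.Injective (put f n) := by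
    intro f n v w h
    rw [← put_self f n v, h, put_self]
  refine ⟨P, inferInstance, ⟨?_, ?_⟩, ?_⟩
  · refine (one_lt_aleph0.trans hκ).trans_le (hW.symm.le.trans ?_)
    exact mk_le_of_injective (put_inj ⟨toLex fun _ => o, 0, fun _ _ => rfl⟩ 0)
  · intro f g hfg
    obtain ⟨n, heq, hn⟩ := (hlt f g).1 hfg
    -- Raising coordinate `n + 1` of `f`, just after the first difference, stays below `g` and
    -- leaves `κ` choices.
    refine (hIoi (f.1 (n + 1))).trans (mk_le_of_injective
      (f := fun w => ⟨put f (n + 1) w.1, ?_, ?_⟩) ?_)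
    · refine (hlt _ _).2 ⟨n + 1, fun m hm => (put_ne _ _ _ _ hm.ne).symm, ?_⟩
      rw [put_self]
      exact w.2
    · refine (hlt _ _).2 ⟨n, fun m hm => ?_, ?_⟩
      · rw [put_ne _ _ _ _ (by omega), heq m hm]
      · rwa [put_ne _ _ _ _ (by omega)]
    · intro v w h
      exact Subtype.ext (put_inj _ _ (congrArg Subtype.val h))
  · refine ⟨ULift ℕ, by simpa using hκ, fun n => {f | ∀ m, n.down ≤ m → f.1 m = o}, fun n => ?_,
      Set.eq_univ_of_forall fun f => Set.mem_iUnion.2 (f.2.imp' ULift.up fun _ h => h)⟩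
    rw [isScattered_aleph0_type_iff]
    -- Sequences equal to `o` from `n` on embed in a finite lexicographic power of `W`, which is
    -- well ordered.
    let t : P → Lex (Fin n.down → W) := fun f => toLex fun i => f.1 i
    have ht : StrictMonoOn t {f | ∀ m, n.down ≤ m → f.1 m = o} := by
      intro f hf g hg hfg
      obtain ⟨k, heq, hk⟩ := (hlt f g).1 hfg
      have hkn : k < n.down := by
        by_contra! h
        rw [hf k h, hg k h] at hk
        exact lt_irrefl _ hk
      exact ⟨⟨k, hkn⟩, fun j hj => heq j hj, hk⟩
    refine SetScattered.of_monotoneOn ht.monotoneOn fun w => setScattered_of_subsingleton ?_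
    rintro f ⟨hf, rfl⟩ g ⟨hg, h⟩
    exact ht.injOn hf hg h.symm

end GenScattered

theorem mainTheorem8 (κ ν : Cardinal.{u}) (hν : ℵ₀ ≤ ν) (hκ : κ = Order.succ ν) :
    GenScattered.scatteredTypes κ ⊂ GenScattered.pairScatteredTypes ℵ₀ κ ∧
      GenScattered.pairScatteredTypes ℵ₀ κ ⊂ GenScattered.weaklyScatteredTypes κ := by
  have hνκ : ν < κ := hκ ▸ Order.lt_succ ν
  refine ⟨(Set.ssubset_iff_exists).2 ⟨GenScattered.scatteredTypes_subset hν hκ, ?_⟩,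
    (Set.ssubset_iff_exists).2 ⟨GenScattered.pairScatteredTypes_subset (hν.trans hνκ.le), ?_⟩⟩
  · obtain ⟨P, _, hd, hu⟩ := GenScattered.exists_dense_isUnionOfScattered (hν.trans_lt hνκ)
    exact ⟨OrderType.type P, GenScattered.isPairScattered_type.2 hu, fun h =>
      h ⟨OrderType.type P, GenScattered.isDenseType_type.2 hd, le_rfl⟩⟩
  · obtain ⟨P, _, hc, hP⟩ := GenScattered.exists_hasCuts hν
    refine ⟨OrderType.type P, ?_, fun h =>
      GenScattered.not_isUnionOfScattered_of_hasCuts hν hκ hc hP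
        (GenScattered.isPairScattered_type.1 h)⟩
    rintro ⟨τ, hτ, hle⟩
    rw [← OrderType.type_toType τ] at hle
    obtain ⟨e⟩ := OrderType.type_le_type_iff.1 hle
    exact GenScattered.IsSaturatedOrder.not_hasCuts hν hνκ hτ (hc.of_embedding e)
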